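/- Let $K$ be a field and let $A$ be a finitely presented associative unital $K$-algebra, not necessarily commutative; that is, there is a surjective $K$-algebra homomorphism from a free associative algebra $K\langle x_1,\dots,x_n\rangle$ onto $A$ whose kernel is finitely generated as a two-sided ideal. Let $I$ be a right ideal of $A$ that is finitely presented as a right $A$-module, and suppose that $AI=A$. Then the $K$-subalgebra $K+I=\{k\cdot 1+x : k\in K,\ x\in I\}$ of $A$ is a finitely presented $K$-algebra. -/

import Mathlib

open scoped MulOpposite

/-- An associative unital `K`-algebra `A`, not assumed commutative, is finitely presented if it is
the image of a free associative algebra `K⟨x₁, …, xₙ⟩` on finitely many generators under a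
homomorphism whose kernel is finitely generated as a two-sided ideal. (Mathlib's
`Algebra.FinitePresentation` uses polynomial rings and is the notion for commutative algebras.) -/
def IsFinPresAlgebra (K A : Type*) [CommRing K] [Ring A] [Algebra K A] : Prop :=
  ∃ (n : ℕ) (π : FreeAlgebra K (Fin n) →ₐ[K] A), Function.Surjective π ∧
    ∃ s : Finset (FreeAlgebra K (Fin n)),
      TwoSidedIdeal.span (s : Set (FreeAlgebra K (Fin n))) = TwoSidedIdeal.ker π

/-- The `K`-subalgebra `K + I = {k·1 + x : k ∈ K, x ∈ I}` of `A`, for a right ideal `I` of `A`.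
A right ideal of `A` is a submodule of the right `A`-module `A`, that is, of `A` as a module over
`Aᵐᵒᵖ`. -/
def scalarsAddRightIdeal (K : Type*) {A : Type*} [CommRing K] [Ring A] [Algebra K A]
    (I : Submodule Aᵐᵒᵖ A) : Subalgebra K A where
  carrier := {a | ∃ k : K, ∃ x ∈ I, a = algebraMap K A k + x}
  algebraMap_mem' k := ⟨k, 0, I.zero_mem, by simp⟩
  add_mem' := by
    rintro _ _ ⟨k, x, hx, rfl⟩ ⟨l, y, hy, rfl⟩
    exact ⟨k + l, x + y, I.add_mem hx hy, by rw [map_add]; abel⟩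
  mul_mem' := by
    rintro _ _ ⟨k, x, hx, rfl⟩ ⟨l, y, hy, rfl⟩
    have h : ∀ z ∈ I, ∀ b : A, z * b ∈ I := fun z hz b => I.smul_mem (MulOpposite.op b) hz
    refine ⟨k * l, y * algebraMap K A k + x * (algebraMap K A l + y),
      I.add_mem (h y hy _) (h x hx _), ?_⟩
    rw [map_mul, ← Algebra.commutes k y]
    noncomm_ring

open Matrix

/-! ### Finite presentation of a subalgebra from a presentation on any finite type -/

section Criterion

variable {K : Type*} [CommRing K] {A : Type*} [Ring A] [Algebra K A]

/-! Choose generators `z i` of `I` and `a i` with `∑ a i * z i = 1`. Then `x ↦ (z i * x * a j)` is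
multiplicative from `A` to matrices over `I`, with `1` going to an idempotent `E`. So products in
`A` can be computed inside `K + I`, which is generated by the `z i * a j`, `z i * x l * a j` and `z
i`.

Impose on free generators the finitely many identities in `cornerRelations`, with quotient `B`. By
`IsCornerModel.cornerSum_mul`, the elements `k + cornerSum f` form a subalgebra of `B`; it contains
the generators, so it is everything. If such an element evaluates to zero in `A`, then `k = 0` (as
`1 ∉ I`), `f` gives a syzygy of the `z i`, and the relations coming from `I` kill `cornerSum f`. If
`1 ∈ I`, then `K + I = A`. -/

theorem isFinPresAlgebra_of_range_eq {G : Type*} [Finite G] (σ : FreeAlgebra K G →ₐ[K] A)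
    {S : Subalgebra K A} (hS : σ.range = S) {s : Set (FreeAlgebra K G)} (hs : s.Finite)
    (h : ∀ w, σ w = 0 ↔ w ∈ TwoSidedIdeal.span s) : IsFinPresAlgebra K S := by
  classical
  subst hS
  obtain ⟨n, ⟨e⟩⟩ := Finite.exists_equiv_fin G
  let ε : FreeAlgebra K (Fin n) ≃ₐ[K] FreeAlgebra K G :=
    AlgEquiv.ofAlgHom (FreeAlgebra.lift K fun i => FreeAlgebra.ι K (e.symm i))
      (FreeAlgebra.lift K fun g => FreeAlgebra.ι K (e g))
      (by ext; simp) (by ext; simp)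
  refine ⟨n, σ.rangeRestrict.comp ε.toAlgHom,
    σ.rangeRestrict_surjective.comp ε.surjective,
    (hs.image ε.symm).toFinset, ?_⟩
  rw [Set.Finite.coe_toFinset]
  apply le_antisymm
  · rw [TwoSidedIdeal.span_le]
    rintro _ ⟨w, hw, rfl⟩
    have : σ w = 0 := (h w).2 (TwoSidedIdeal.subset_span hw)
    simpa [TwoSidedIdeal.mem_ker, Subtype.ext_iff] using this
  · intro x hx
    have hx' : σ (ε x) = 0 := by
      simpa [TwoSidedIdeal.mem_ker, Subtype.ext_iff] using hx
    have key : TwoSidedIdeal.span s ≤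
        TwoSidedIdeal.comap (ε.symm : FreeAlgebra K G →+* FreeAlgebra K (Fin n))
          (TwoSidedIdeal.span (ε.symm '' s)) := by
      rw [TwoSidedIdeal.span_le]
      intro w hw
      exact (TwoSidedIdeal.mem_comap _).2 (TwoSidedIdeal.subset_span ⟨w, hw, rfl⟩)
    have := (TwoSidedIdeal.mem_comap _).1 (key ((h _).1 hx'))
    simpa using this

end Criterion

/-! ### Calculus in an abstract corner model -/

section Corner

variable {K A F B ι : Type*} [CommRing K] [Ring A] [Algebra K A] [Ring F] [Algebra K F]
  [Ring B] [Algebra K B] [Fintype ι] [DecidableEq ι]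

/-- The formal counterpart in `B` of the element `∑ i, z i * π (f i)` of a right ideal generated
by the `z i`, where `E * φ f` stands for the matrix with entries `z i * π f * a j`. -/
def cornerSum (φ : F →ₐ[K] Matrix ι ι B) (E : Matrix ι ι B) (Z : ι → B) :
    (ι → F) →ₗ[K] B where
  toFun f := ∑ i, ((E * φ (f i)) *ᵥ Z) i
  map_add' f g := by
    simp [Matrix.mul_add, Matrix.add_mulVec, Finset.sum_add_distrib]
  map_smul' c f := by
    simp [Matrix.smul_mulVec, Finset.smul_sum]

/-- `E`, `Z` and `φ` satisfy in `B` the identities satisfied in `A` by the matrices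
`z i * a j`, `z i` and `z i * π f * a j`, where the `ζ i` are lifts of the `z i`. -/
structure IsCornerModel (π : F →ₐ[K] A) (z : ι → A) (ζ : ι → F)
    (φ : F →ₐ[K] Matrix ι ι B) (E : Matrix ι ι B) (Z : ι → B) : Prop where
  comm : ∀ f, E * φ f = φ f * E
  mulVec : E *ᵥ Z = Z
  rel : ∀ f : ι → F, ∑ i, z i * π (f i) = 0 → cornerSum φ E Z f = 0
  lift : ∀ i p q, (E * φ (ζ i)) p q = Z p * E i q

variable {π : F →ₐ[K] A} {z : ι → A} {ζ : ι → F} {φ : F →ₐ[K] Matrix ι ι B}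
  {E : Matrix ι ι B} {Z : ι → B}

/-- As `E` fixes `Z` and commutes with `φ`, a factor `E` may be inserted; then `lift` turns `E * φ
(ζ i)` into the rank-one product of `Z` with row `i` of `E`. -/
theorem IsCornerModel.mulVec_lift (h : IsCornerModel π z ζ φ E Z) (g : ι → F) :
    φ (∑ i, ζ i * g i) *ᵥ Z = fun p => Z p * cornerSum φ E Z g := by
  have h1 : ∀ f, φ f *ᵥ Z = (E * φ f) *ᵥ Z := fun f => by
    rw [h.comm, ← Matrix.mulVec_mulVec, h.mulVec]
  have h2 : ∀ i, φ (ζ i * g i) *ᵥ Z = fun p => Z p * ((E * φ (g i)) *ᵥ Z) i := fun i => by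
    rw [h1, map_mul, ← Matrix.mul_assoc, ← Matrix.mulVec_mulVec Z (E * φ (ζ i)),
      ← Matrix.mulVec_mulVec Z E (φ (g i))]
    funext p
    change ∑ j, (E * φ (ζ i)) p j * (φ (g i) *ᵥ Z) j = Z p * ∑ j, E i j * (φ (g i) *ᵥ Z) j
    simp_rw [h.lift, mul_assoc, Finset.mul_sum]
  rw [map_sum, Matrix.sum_mulVec]
  funext p
  rw [Finset.sum_apply]
  simp_rw [h2, ← Finset.mul_sum]
  rfl

theorem IsCornerModel.cornerSum_mul (h : IsCornerModel π z ζ φ E Z) (f g : ι → F) :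
    cornerSum φ E Z f * cornerSum φ E Z g =
      cornerSum φ E Z fun i => f i * ∑ j, ζ j * g j := by
  have h2 : ∀ i, (E * φ (f i * ∑ j, ζ j * g j)) *ᵥ Z =
      fun p => ((E * φ (f i)) *ᵥ Z) p * cornerSum φ E Z g := fun i => by
    rw [map_mul, ← Matrix.mul_assoc, ← Matrix.mulVec_mulVec, h.mulVec_lift]
    funext p
    simp [Matrix.mulVec, dotProduct, Finset.sum_mul, mul_assoc]
  conv_rhs => simp only [cornerSum, LinearMap.coe_mk, AddHom.coe_mk, h2]
  rw [← Finset.sum_mul]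
  rfl

/-- Pairs of an element of `B` and an element of `A` with a common expression
`k + ∑ i, z i * π (f i)`. -/
def IsCornerModel.graph (h : IsCornerModel π z ζ φ E Z) (hζ : ∀ i, π (ζ i) = z i) :
    Subalgebra K (B × A) where
  carrier := {x | ∃ (k : K) (f : ι → F), x = (algebraMap K B k + cornerSum φ E Z f,
    algebraMap K A k + ∑ i, z i * π (f i))}
  algebraMap_mem' k := ⟨k, 0, by simp⟩
  add_mem' := by
    rintro _ _ ⟨k, f, rfl⟩ ⟨l, g, rfl⟩
    refine ⟨k + l, f + g, ?_⟩
    simp only [Prod.mk_add_mk, map_add, Pi.add_apply, mul_add, Finset.sum_add_distrib]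
    congr 1 <;> abel
  mul_mem' := by
    rintro _ _ ⟨k, f, rfl⟩ ⟨l, g, rfl⟩
    -- Expand `(k + u) * (l + v)`; the last summand represents `u * v`.
    refine ⟨k * l, k • g + l • f + fun i => f i * ∑ j, ζ j * g j, ?_⟩
    rw [Prod.mk_mul_mk]
    congr 1
    · rw [map_add, map_add, map_smul, map_smul, ← h.cornerSum_mul, Algebra.smul_def,
        Algebra.smul_def, map_mul, Algebra.commutes l (cornerSum φ E Z f)]
      noncomm_ring
    · have h3 : ∑ i, z i * π ((k • g + l • f + fun i => f i * ∑ j, ζ j * g j) i) =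
          k • (∑ i, z i * π (g i)) + l • (∑ i, z i * π (f i)) +
            (∑ i, z i * π (f i)) * ∑ i, z i * π (g i) := by
        simp [mul_add, Finset.sum_add_distrib, Finset.smul_sum, Finset.sum_mul, hζ, mul_assoc]
      rw [h3, Algebra.smul_def, Algebra.smul_def, map_mul,
        Algebra.commutes l (∑ i, z i * π (f i))]
      noncomm_ring

end Corner

/-! ### Generators and relations for `K + I` -/

section Relations

variable {K A ι κ X : Type*} [CommRing K] [Ring A] [Algebra K A] [Fintype ι] [DecidableEq ι]

/-- Index type of the generators `z i * a j`, `z i * x l * a j` and `z i` of `K + I`. -/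
abbrev CornerGen (ι X : Type*) := (ι × ι) ⊕ (X × ι × ι) ⊕ ι

variable (K ι X) in
/-- The generic matrix whose entries stand for `z i * a j`. -/
def genE : Matrix ι ι (FreeAlgebra K (CornerGen ι X)) :=
  .of fun i j => FreeAlgebra.ι K (.inl (i, j))

variable (K ι) in
/-- The generic matrices whose entries stand for `z i * x l * a j`. -/
def genV (l : X) : Matrix ι ι (FreeAlgebra K (CornerGen ι X)) :=
  .of fun i j => FreeAlgebra.ι K (.inr (.inl (l, i, j)))

variable (K ι X) in
/-- The generic column whose entries stand for `z i`. -/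
def genZ (i : ι) : FreeAlgebra K (CornerGen ι X) := FreeAlgebra.ι K (.inr (.inr i))

variable (K ι X) in
/-- The homomorphism sending `x l` to the generic matrix `genV l`. -/
def genHom : FreeAlgebra K X →ₐ[K] Matrix ι ι (FreeAlgebra K (CornerGen ι X)) :=
  FreeAlgebra.lift K (genV K ι)

/-- The defining relations of `K + I`, given defining relations `r` of `A`, defining relations
`ρ` of `I`, and lifts `ζ` and `α` of `z` and `a`. -/
def cornerRelations (r : Set (FreeAlgebra K X)) (ρ : κ → ι → FreeAlgebra K X)
    (ζ α : ι → FreeAlgebra K X) : Set (FreeAlgebra K (CornerGen ι X)) :=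
  let E := genE K ι X
  let Z := genZ K ι X
  let φ := genHom K ι X
  Set.range (fun t : X × ι × ι => (E * genV K ι t.1 - genV K ι t.1 * E) t.2.1 t.2.2) ∪
  Set.range (fun i => (E *ᵥ Z) i - Z i) ∪
  (⋃ i, ⋃ j, (fun f => (E * φ f) i j) '' r) ∪
  Set.range (fun t : κ × ι => ∑ i, (E * φ (ρ t.1 i)) i t.2) ∪
  Set.range (fun t : ι × ι × ι => (E * φ (ζ t.1)) t.2.1 t.2.2 - Z t.2.1 * E t.1 t.2.2) ∪
  Set.range (fun t : ι × ι => ((E * φ (α t.2)) *ᵥ Z) t.1 - E t.1 t.2) ∪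
  Set.range (fun t : X × ι × ι => ((E * φ (FreeAlgebra.ι K t.1 * α t.2.2)) *ᵥ Z) t.2.1
    - genV K ι t.1 t.2.1 t.2.2)

end Relations

/-! ### Evaluation in `A` and faithfulness of the presentation -/

section Presentation

variable {K A ι κ X : Type*} [CommRing K] [Ring A] [Algebra K A]

variable {π : FreeAlgebra K X →ₐ[K] A} {z a : ι → A}

variable (π z a) in
/-- Evaluation of the generators of `K + I` in `A`. -/
def cornerEval : FreeAlgebra K (CornerGen ι X) →ₐ[K] A :=
  FreeAlgebra.lift K (Sum.elim (fun t => z t.1 * a t.2)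
    (Sum.elim (fun t => z t.2.1 * π (FreeAlgebra.ι K t.1) * a t.2.2) z))

@[simp] theorem cornerEval_genE (i j : ι) :
    cornerEval π z a (genE K ι X i j) = z i * a j := by
  simp [cornerEval, genE]

@[simp] theorem cornerEval_genV (l : X) (i j : ι) :
    cornerEval π z a (genV K ι l i j) = z i * π (FreeAlgebra.ι K l) * a j := by
  simp [cornerEval, genV]

@[simp] theorem cornerEval_genZ (i : ι) : cornerEval π z a (genZ K ι X i) = z i := by
  simp [cornerEval, genZ]

variable [Fintype ι]

theorem sum_mul_sandwich (haz : ∑ i, a i * z i = 1) (x y : A) :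
    ∑ j, x * a j * (z j * y) = x * y := by
  have : ∀ j, x * a j * (z j * y) = x * (a j * z j) * y := fun j => by noncomm_ring
  simp_rw [this, ← Finset.sum_mul, ← Finset.mul_sum, haz, mul_one]

variable [DecidableEq ι]


theorem map_cornerSum {F B C : Type*} [Ring F] [Algebra K F] [Ring B] [Algebra K B] [Ring C]
    [Algebra K C] (q : B →ₐ[K] C) (φ : F →ₐ[K] Matrix ι ι B) (E : Matrix ι ι B) (Z : ι → B)
    (f : ι → F) :
    q (cornerSum φ E Z f) = cornerSum (q.mapMatrix.comp φ) (q.mapMatrix E) (q ∘ Z) f := by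
  simp only [cornerSum, LinearMap.coe_mk, AddHom.coe_mk, map_sum, AlgHom.comp_apply, ← map_mul]
  exact Finset.sum_congr rfl fun i _ => RingHom.map_mulVec (q : B →+* C) _ _ _

theorem TwoSidedIdeal.mkₐ_eq_zero_iff {R : Type*} [Ring R] [Algebra K R] (J : TwoSidedIdeal R)
    (x : R) : J.ringCon.mkₐ (α := K) x = 0 ↔ x ∈ J := by
  rw [TwoSidedIdeal.mem_iff, ← map_zero (J.ringCon.mkₐ (α := K))]
  exact J.ringCon.eq

theorem commute_freeAlgebra_of_generators {R : Type*} [Ring R] [Algebra K R]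
    (φ : FreeAlgebra K X →ₐ[K] R) (e : R)
    (h : ∀ l, e * φ (FreeAlgebra.ι K l) = φ (FreeAlgebra.ι K l) * e) (f : FreeAlgebra K X) :
    e * φ f = φ f * e := by
  induction f with
  | grade0 k => rw [AlgHom.commutes, Algebra.commutes]
  | grade1 l => exact h l
  | mul f g hf hg => rw [map_mul, ← mul_assoc, hf, mul_assoc, hg, mul_assoc]
  | add f g hf hg => rw [map_add, mul_add, add_mul, hf, hg]

/-- Commutation makes the set of `f` with `e * φ f = 0` a two-sided ideal, so imposing `E * φ f = 0`
on the finitely many relators of `A` suffices. -/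
theorem mul_map_eq_zero_of_mem_span {F R : Type*} [Ring F] [Ring R]
    (φ : F →+* R) (e : R) (comm : ∀ f, e * φ f = φ f * e) {r : Set F}
    (h : ∀ f ∈ r, e * φ f = 0) {f : F} (hf : f ∈ TwoSidedIdeal.span r) : e * φ f = 0 := by
  induction hf using TwoSidedIdeal.span_induction with
  | mem f hf => exact h f hf
  | zero => simp
  | add f g _ _ hf hg => rw [map_add, mul_add, hf, hg, add_zero]
  | neg f _ hf => rw [map_neg, mul_neg, hf, neg_zero]
  | left_absorb b f _ hf => rw [map_mul, ← mul_assoc, comm, mul_assoc, hf, mul_zero]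
  | right_absorb b f _ hf => rw [map_mul, ← mul_assoc, hf, zero_mul]

/-- `genHom` is unital while `x ↦ (z i * x * a j)` sends `1` to an idempotent, so the two agree only
after multiplying by `genE`. -/
theorem mapMatrix_genE_mul_genHom (haz : ∑ i, a i * z i = 1) (f : FreeAlgebra K X) :
    (cornerEval π z a).mapMatrix (genE K ι X * genHom K ι X f) =
      .of fun i j => z i * π f * a j := by
  set σ := (cornerEval π z a).mapMatrix (m := ι) with hσ
  have hE : σ (genE K ι X) = .of fun i j => z i * a j := by
    ext i j; simp [hσ]
  have hmul : ∀ x y : A, (.of fun i j => z i * x * a j : Matrix ι ι A) *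
      (.of fun i j => z i * y * a j) = .of fun i j => z i * (x * y) * a j := by
    intro x y
    ext i j
    simp only [Matrix.mul_apply, Matrix.of_apply]
    have := sum_mul_sandwich haz (z i * x) (y * a j)
    simpa only [mul_assoc] using this
  have hE1 : σ (genE K ι X) = .of fun i j => z i * 1 * a j := by simp [hE]
  have hV : ∀ l, σ (genV K ι l) = .of fun i j => z i * π (FreeAlgebra.ι K l) * a j := by
    intro l; ext i j; simp [hσ]
  have comm : ∀ f, σ (genE K ι X) * σ (genHom K ι X f) = σ (genHom K ι X f) * σ (genE K ι X) := by
    refine commute_freeAlgebra_of_generators (σ.comp (genHom K ι X)) _ fun l => ?_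
    have : (σ.comp (genHom K ι X)) (FreeAlgebra.ι K l) = σ (genV K ι l) := by simp [genHom]
    rw [this, hV, hE1, hmul, hmul, one_mul, mul_one]
  have idem : σ (genE K ι X) * σ (genE K ι X) = σ (genE K ι X) := by
    rw [hE1, hmul, one_mul]
  rw [map_mul]
  induction f with
  | grade0 k =>
    rw [AlgHom.commutes, AlgHom.commutes, AlgHom.commutes, hE, ← Algebra.commutes,
      ← Algebra.smul_def]
    ext i j
    simp [Algebra.smul_def, mul_assoc, Algebra.commutes]
  | grade1 l =>
    have : genHom K ι X (FreeAlgebra.ι K l) = genV K ι l := by simp [genHom]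
    rw [this, hV, hE1, hmul, one_mul]
  | mul f g hf hg =>
    -- Double the idempotent and move one copy past the image of `f`, giving each factor its own.
    rw [map_mul, map_mul, ← idem, mul_assoc, ← mul_assoc _ (σ (genHom K ι X f)), comm,
      mul_assoc, ← mul_assoc, hf, hg, hmul, map_mul]
  | add f g hf hg =>
    rw [map_add, map_add, mul_add, hf, hg, map_add]
    ext i j
    simp [mul_add, add_mul]

theorem cornerEval_genE_mul_genHom (haz : ∑ i, a i * z i = 1) (f : FreeAlgebra K X) (i j : ι) :
    cornerEval π z a ((genE K ι X * genHom K ι X f) i j) = z i * π f * a j :=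
  congr_fun₂ (mapMatrix_genE_mul_genHom haz f) i j

theorem cornerEval_mulVec_genZ (haz : ∑ i, a i * z i = 1) (f : FreeAlgebra K X) (i : ι) :
    cornerEval π z a (((genE K ι X * genHom K ι X f) *ᵥ genZ K ι X) i) = z i * π f := by
  have := sum_mul_sandwich haz (z i * π f) 1
  simpa [Matrix.mulVec, dotProduct, cornerEval_genE_mul_genHom haz] using this

theorem cornerEval_cornerSum (haz : ∑ i, a i * z i = 1) (f : ι → FreeAlgebra K X) :
    cornerEval π z a (cornerSum (genHom K ι X) (genE K ι X) (genZ K ι X) f) =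
      ∑ i, z i * π (f i) := by
  simp [cornerSum, cornerEval_mulVec_genZ haz]

variable {r : Set (FreeAlgebra K X)} {ρ : κ → ι → FreeAlgebra K X} {ζ α : ι → FreeAlgebra K X}

theorem cornerEval_eq_zero_of_mem_cornerRelations (haz : ∑ i, a i * z i = 1)
    (hζ : ∀ i, π (ζ i) = z i) (hα : ∀ i, π (α i) = a i) (hr : ∀ f ∈ r, π f = 0)
    (hρ : ∀ k, ∑ i, z i * π (ρ k i) = 0) {w : FreeAlgebra K (CornerGen ι X)}
    (hw : w ∈ cornerRelations r ρ ζ α) : cornerEval π z a w = 0 := by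
  simp only [cornerRelations, Set.mem_union, Set.mem_range, Set.mem_iUnion, Set.mem_image] at hw
  rcases hw with (((((⟨⟨l, i, j⟩, rfl⟩ | ⟨i, rfl⟩) | ⟨i, j, f, hf, rfl⟩) | ⟨⟨k, j⟩, rfl⟩) |
    ⟨⟨i, p, q⟩, rfl⟩) | ⟨⟨i, j⟩, rfl⟩) | ⟨⟨l, i, j⟩, rfl⟩
  · have h1 := sum_mul_sandwich haz (z i) (π (FreeAlgebra.ι K l) * a j)
    have h2 := sum_mul_sandwich haz (z i * π (FreeAlgebra.ι K l)) (a j)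
    simp only [mul_assoc] at h1 h2
    simp [Matrix.mul_apply, mul_assoc, h1, h2]
  · have := cornerEval_mulVec_genZ (π := π) haz 1 i
    rw [map_one, mul_one] at this
    simp [this]
  · simp [cornerEval_genE_mul_genHom haz, hr f hf]
  · simp [cornerEval_genE_mul_genHom haz, ← Finset.sum_mul, hρ]
  · simp [cornerEval_genE_mul_genHom haz, hζ, mul_assoc]
  · simp [cornerEval_mulVec_genZ haz, hα]
  · rw [map_sub, cornerEval_mulVec_genZ haz]
    simp [hα, mul_assoc]

theorem finite_cornerRelations [Finite X] [Finite κ] (hr : r.Finite) :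
    (cornerRelations r ρ ζ α).Finite := by
  unfold cornerRelations
  refine ((((((Set.finite_range _).union (Set.finite_range _)).union ?_).union
    (Set.finite_range _)).union (Set.finite_range _)).union (Set.finite_range _)).union
    (Set.finite_range _)
  exact Set.finite_iUnion fun i => Set.finite_iUnion fun j => hr.image _

/-- The identities imposed by `cornerRelations` make its quotient a corner model. -/
theorem isCornerModel_of_cornerRelations [Fintype κ] {B : Type*} [Ring B] [Algebra K B]
    (q : FreeAlgebra K (CornerGen ι X) →ₐ[K] B) (hq : ∀ w ∈ cornerRelations r ρ ζ α, q w = 0)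
    (hker : ∀ f, π f = 0 → f ∈ TwoSidedIdeal.span r)
    (hsyz : ∀ f : ι → FreeAlgebra K X, ∑ i, z i * π (f i) = 0 →
      ∃ β : κ → FreeAlgebra K X, ∀ i, π (f i) = ∑ k, π (ρ k i) * π (β k)) :
    IsCornerModel π z ζ (q.mapMatrix.comp (genHom K ι X)) (q.mapMatrix (genE K ι X))
      (q ∘ genZ K ι X) := by
  simp only [cornerRelations, Set.mem_union, or_imp, forall_and, Set.forall_mem_range,
    Set.mem_iUnion, Set.mem_image, Prod.forall] at hq
  obtain ⟨⟨⟨⟨⟨⟨hcomm, hZ⟩, hr⟩, hρ⟩, hζ⟩, -⟩, -⟩ := hq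
  set φ := q.mapMatrix.comp (genHom K ι X) with hφ
  set E := q.mapMatrix (genE K ι X) with hE
  have hEφ : ∀ f i j, (E * φ f) i j = q ((genE K ι X * genHom K ι X f) i j) := fun f i j => by
    rw [hE, hφ, AlgHom.comp_apply, ← map_mul]; rfl
  have comm : ∀ f, E * φ f = φ f * E := by
    refine commute_freeAlgebra_of_generators φ E fun l => ?_
    have hl : genHom K ι X (FreeAlgebra.ι K l) = genV K ι l := by simp [genHom]
    rw [hφ, AlgHom.comp_apply, hE, ← map_mul, ← map_mul, hl, ← sub_eq_zero, ← map_sub]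
    ext i j
    exact hcomm l i j
  have hzero : ∀ f, π f = 0 → E * φ f = 0 := fun f hf => by
    refine mul_map_eq_zero_of_mem_span (φ : FreeAlgebra K X →+* Matrix ι ι B) E comm
      (fun g hg => ?_) (hker f hf)
    ext i j
    exact (hEφ g i j).trans (hr _ ⟨i, j, g, hg, rfl⟩)
  refine ⟨comm, ?_, fun f hf => ?_, fun i s t => ?_⟩
  · funext i
    have := hZ i
    rw [map_sub, sub_eq_zero] at this
    exact (RingHom.map_mulVec (q : FreeAlgebra K (CornerGen ι X) →+* B) _ _ i).symm.trans this
  · obtain ⟨β, hβ⟩ := hsyz f hf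
    -- The two sides come from elements of the free algebra that differ by an element of `ker π`,
    -- which `E * φ` kills.
    have h1 : ∀ i, E * φ (f i) = ∑ k, E * φ (ρ k i) * φ (β k) := fun i => by
      have := hzero (f i - ∑ k, ρ k i * β k) (by simp [hβ])
      rw [map_sub, mul_sub, sub_eq_zero] at this
      simpa [Finset.mul_sum, mul_assoc] using this
    have h2 : ∀ k, ∑ i, ((E * φ (ρ k i) * φ (β k)) *ᵥ (q ∘ genZ K ι X)) i = 0 := fun k => by
      simp_rw [fun i => (Matrix.mulVec_mulVec (q ∘ genZ K ι X) (E * φ (ρ k i)) (φ (β k))).symm]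
      simp only [Matrix.mulVec, dotProduct]
      rw [Finset.sum_comm]
      refine Finset.sum_eq_zero fun j _ => ?_
      rw [← Finset.sum_mul]
      have := hρ k j
      rw [map_sum] at this
      simp_rw [hEφ, this, zero_mul]
    change ∑ i, ((E * φ (f i)) *ᵥ (q ∘ genZ K ι X)) i = 0
    simp_rw [h1, Matrix.sum_mulVec, Finset.sum_apply]
    rw [Finset.sum_comm]
    exact Finset.sum_eq_zero fun k _ => h2 k
  · have := hζ i s t
    rw [map_sub, sub_eq_zero, map_mul] at this
    exact (hEφ _ _ _).trans this

/-- `model.graph` gives each word one expression valid in both `B` and `A`, so a vanishing value in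
`A` can be read off in `B`; `hindep` first removes the scalar. -/
theorem isFinPresAlgebra_of_cornerData [Finite X] [Fintype κ] (haz : ∑ i, a i * z i = 1)
    (hζ : ∀ i, π (ζ i) = z i) (hα : ∀ i, π (α i) = a i) (hrfin : r.Finite)
    (hr : TwoSidedIdeal.span r = TwoSidedIdeal.ker π)
    (hρ : ∀ k, ∑ i, z i * π (ρ k i) = 0)
    (hsyz : ∀ f : ι → FreeAlgebra K X, ∑ i, z i * π (f i) = 0 →
      ∃ β : κ → FreeAlgebra K X, ∀ i, π (f i) = ∑ k, π (ρ k i) * π (β k))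
    (hindep : ∀ (k : K) (f : ι → FreeAlgebra K X),
      algebraMap K A k + ∑ i, z i * π (f i) = 0 → k = 0)
    (S : Subalgebra K A)
    (hS : ∀ x, x ∈ S ↔ ∃ (k : K) (f : ι → FreeAlgebra K X),
      x = algebraMap K A k + ∑ i, z i * π (f i)) :
    IsFinPresAlgebra K S := by
  have hker : ∀ f, π f = 0 ↔ f ∈ TwoSidedIdeal.span r := fun f => by
    rw [hr, TwoSidedIdeal.mem_ker]
  set J := TwoSidedIdeal.span (cornerRelations r ρ ζ α) with hJ
  set q := J.ringCon.mkₐ (α := K) with hq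
  have hqJ : ∀ w, q w = 0 ↔ w ∈ J := J.mkₐ_eq_zero_iff
  have hrel : ∀ w ∈ cornerRelations r ρ ζ α, q w = 0 := fun w hw =>
    (hqJ w).2 (TwoSidedIdeal.subset_span hw)
  have model := isCornerModel_of_cornerRelations q hrel (fun f hf => (hker f).1 hf) hsyz
  have hgraph : ∀ w, (q w, cornerEval π z a w) ∈ model.graph hζ := by
    have hgen : ∀ g, (q (FreeAlgebra.ι K g), cornerEval π z a (FreeAlgebra.ι K g)) ∈
        model.graph hζ := by
      have single : ∀ i f, (q (((genE K ι X * genHom K ι X f) *ᵥ genZ K ι X) i), z i * π f) ∈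
          model.graph hζ := fun i f => by
        refine ⟨0, Pi.single i f, ?_⟩
        rw [← map_cornerSum, map_zero, zero_add, map_zero, zero_add]
        congr 1
        · congr 1
          simp only [cornerSum, LinearMap.coe_mk, AddHom.coe_mk]
          rw [Finset.sum_eq_single i]
          · simp
          · intro j _ hj; simp [hj]
          · simp
        · rw [Finset.sum_eq_single i]
          · simp
          · intro j _ hj; simp [hj]
          · simp
      simp only [cornerRelations, Set.mem_union, or_imp, forall_and, Set.forall_mem_range,
        Set.mem_iUnion, Set.mem_image, Prod.forall, map_sub, sub_eq_zero] at hrel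
      -- These three families write every generator as an entry of `(E * φ f) *ᵥ Z`, hence as a
      -- `cornerSum` with one nonzero coordinate.
      obtain ⟨⟨⟨⟨⟨⟨-, hZ⟩, -⟩, -⟩, -⟩, hE⟩, hV⟩ := hrel
      rintro (⟨i, j⟩ | ⟨l, i, j⟩ | i)
      · have := single i (α j)
        rw [hE i j, hα, ← cornerEval_genE (π := π)] at this
        exact this
      · have := single i (FreeAlgebra.ι K l * α j)
        rw [hV l i j, map_mul, hα, ← mul_assoc, ← cornerEval_genV (π := π)] at this
        exact this
      · have := single i 1
        rw [map_one, map_one, mul_one, mul_one, hZ i, ← cornerEval_genZ (π := π) (z := z) (a := a)] at this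
        exact this
    intro w
    induction w with
    | grade0 k =>
      rw [AlgHom.commutes, AlgHom.commutes]
      exact (model.graph hζ).algebraMap_mem k
    | grade1 g => exact hgen g
    | mul v w hv hw => rw [map_mul, map_mul]; exact mul_mem hv hw
    | add v w hv hw => rw [map_add, map_add]; exact add_mem hv hw
  refine isFinPresAlgebra_of_range_eq (cornerEval π z a) (le_antisymm ?_ ?_)
    (finite_cornerRelations hrfin (ρ := ρ) (ζ := ζ) (α := α)) fun w => ⟨fun hw => ?_, fun hw => ?_⟩
  · rintro _ ⟨w, rfl⟩
    obtain ⟨k, f, h⟩ := hgraph w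
    exact (hS _).2 ⟨k, f, congr_arg Prod.snd h⟩
  · intro x hx
    obtain ⟨k, f, rfl⟩ := (hS x).1 hx
    refine ⟨algebraMap K _ k + cornerSum (genHom K ι X) (genE K ι X) (genZ K ι X) f, ?_⟩
    simp [cornerEval_cornerSum haz]
  · rw [← hqJ]
    obtain ⟨k, f, h⟩ := hgraph w
    have h2 : cornerEval π z a w = algebraMap K A k + ∑ i, z i * π (f i) := congr_arg Prod.snd h
    have h1 : q w = _ := congr_arg Prod.fst h
    rw [hw] at h2
    have hk := hindep k f h2.symm
    subst hk
    rw [map_zero, zero_add] at h1 h2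
    rw [h1]
    exact model.rel f h2.symm
  · have : TwoSidedIdeal.span (cornerRelations r ρ ζ α) ≤
        TwoSidedIdeal.ker (cornerEval π z a) := by
      rw [TwoSidedIdeal.span_le]
      intro v hv
      exact (TwoSidedIdeal.mem_ker _).2 (cornerEval_eq_zero_of_mem_cornerRelations haz hζ hα
        (fun f hf => (hker f).2 (TwoSidedIdeal.subset_span hf)) hρ hv)
    exact (TwoSidedIdeal.mem_ker _).1 (this hw)

end Presentation

/-! ### Choice of generators and conclusion -/

theorem exists_fintype_generators_sum_eq_one {A : Type*} [Ring A] (I : Submodule Aᵐᵒᵖ A)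
    (hfg : Module.Finite Aᵐᵒᵖ I) (hAI : Ideal.span (I : Set A) = ⊤) :
    ∃ (T : Finset I) (a : T → A), Submodule.span Aᵐᵒᵖ (T : Set I) = ⊤ ∧
      ∑ i : T, a i * ((i : I) : A) = 1 := by
  classical
  obtain ⟨T₀, hT₀⟩ := hfg.fg_top
  obtain ⟨c, hc, hc1⟩ := Submodule.mem_span_set.1
    (hAI ▸ Submodule.mem_top : (1 : A) ∈ Ideal.span (I : Set A))
  let T₁ : Finset I := c.support.attach.image fun x => ⟨x.1, hc x.2⟩
  -- `T₀` generates `I` and `T₁` carries an expression of `1`; off `T₁` the coefficient `c` is zero.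
  refine ⟨T₀ ∪ T₁, fun i => c (i : I), ?_, ?_⟩
  · rw [eq_top_iff, ← hT₀]
    exact Submodule.span_mono (by simp)
  · rw [Finset.sum_coe_sort (T₀ ∪ T₁) fun i : I => c (i : A) * (i : A), ← hc1, Finsupp.sum]
    rw [← Finset.sum_subset (Finset.subset_union_right : T₁ ⊆ T₀ ∪ T₁)]
    · rw [Finset.sum_image]
      · exact Finset.sum_attach c.support fun x => c x * x
      · intro x _ y _ h
        exact Subtype.ext (congr_arg (fun t : I => (t : A)) h)
    · intro x _ hx
      have : c (x : A) = 0 := by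
        by_contra h
        exact hx (Finset.mem_image.2 ⟨⟨x, Finsupp.mem_support_iff.2 h⟩, by simp⟩)
      rw [this, zero_mul]

theorem theorem4p7 {K A : Type*} [Field K] [Ring A] [Algebra K A]
    (hA : IsFinPresAlgebra K A)
    (I : Submodule Aᵐᵒᵖ A)
    (hI : Module.FinitePresentation Aᵐᵒᵖ I)
    (hAI : Ideal.span (I : Set A) = ⊤) :
    IsFinPresAlgebra K (scalarsAddRightIdeal K I) := by
  classical
  obtain ⟨n, π, hπ, r, hr⟩ := hA
  by_cases h1 : (1 : A) ∈ I
  · refine isFinPresAlgebra_of_range_eq π ?_ r.finite_toSet fun w => ?_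
    · rw [(AlgHom.range_eq_top π).2 hπ, eq_comm, eq_top_iff]
      intro x _
      exact ⟨0, x, by simpa using I.smul_mem (MulOpposite.op x) h1, by simp⟩
    · rw [hr, TwoSidedIdeal.mem_ker]
  obtain ⟨T, a, hT, haz⟩ := exists_fintype_generators_sum_eq_one I inferInstance hAI
  let z : T → A := fun i => ((i : I) : A)
  let L := Fintype.linearCombination Aᵐᵒᵖ (fun i : T => (i : I))
  have hLval : ∀ b, (L b : A) = ∑ i, z i * (b i).unop := fun b => by
    simp [L, z, Fintype.linearCombination_apply]
  have hL : Function.Surjective L := by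
    rw [← LinearMap.range_eq_top, Fintype.range_linearCombination]
    simpa using hT
  obtain ⟨R, hR⟩ := Module.FinitePresentation.fg_ker L hL
  choose lift hlift using hπ
  have hIlift : ∀ x ∈ I, ∃ f : T → FreeAlgebra K (Fin n), x = ∑ i, z i * π (f i) := by
    intro x hx
    obtain ⟨b, hb⟩ := hL ⟨x, hx⟩
    refine ⟨fun i => lift (b i).unop, ?_⟩
    simp_rw [hlift, ← hLval, hb]
  have hsum : ∀ f : T → FreeAlgebra K (Fin n), ∑ i, z i * π (f i) ∈ I := fun f =>
    I.sum_mem fun i _ => I.smul_mem (MulOpposite.op (π (f i))) (i : I).2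
  refine isFinPresAlgebra_of_cornerData (π := π) (z := z) (a := a) (r := r)
    (ρ := fun (k : R) i => lift ((k : T → Aᵐᵒᵖ) i).unop) (ζ := fun i => lift (z i))
    (α := fun i => lift (a i)) haz (fun i => hlift _) (fun i => hlift _) r.finite_toSet hr
    (fun k => ?_) (fun f hf => ?_) (fun k f hf => ?_) _ fun x => ?_
  · have hk : (k : T → Aᵐᵒᵖ) ∈ LinearMap.ker L := hR ▸ Submodule.subset_span k.2
    simp_rw [hlift, ← hLval, LinearMap.mem_ker.1 hk, ZeroMemClass.coe_zero]
  · have hk : (fun i => MulOpposite.op (π (f i))) ∈ LinearMap.ker L := by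
      rw [LinearMap.mem_ker, Subtype.ext_iff, hLval]
      exact hf
    rw [← hR] at hk
    obtain ⟨β, hβ⟩ := Submodule.mem_span_finset'.1 hk
    refine ⟨fun k => lift (β k).unop, fun i => ?_⟩
    have := congr_arg MulOpposite.unop (congr_fun hβ i)
    simp_rw [hlift]
    simpa using this.symm
  -- A nonzero scalar in `I` is invertible because `K` is a field, which would put `1` in `I`.
  · by_contra hk
    apply h1
    have hmem : algebraMap K A k ∈ I := by
      rw [eq_neg_of_add_eq_zero_left hf]
      exact I.neg_mem (hsum f)
    have := I.smul_mem (MulOpposite.op (algebraMap K A k⁻¹)) hmem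
    rwa [op_smul_eq_mul, ← map_mul, mul_inv_cancel₀ hk, map_one] at this
  · constructor
    · rintro ⟨k, y, hy, rfl⟩
      obtain ⟨f, rfl⟩ := hIlift y hy
      exact ⟨k, f, rfl⟩
    · rintro ⟨k, f, rfl⟩
      exact ⟨k, _, hsum f, rfl⟩
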